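/- For $n\ge 1$ let $B_n$ be the braid group on $n$ strands, given by Artin's presentation: it is generated by $\sigma_1,\dots,\sigma_{n-1}$, subject to the relations $\sigma_i\sigma_j=\sigma_j\sigma_i$ whenever $|i-j|>1$ and $\sigma_i\sigma_j\sigma_i=\sigma_j\sigma_i\sigma_j$ whenever $|i-j|=1$. Let $$\Delta=\sigma_1(\sigma_2\sigma_1)(\sigma_3\sigma_2\sigma_1)\cdots(\sigma_{n-1}\sigma_{n-2}\cdots\sigma_1)\in B_n .$$ **Theorem (Garside).** If $n>2$, then the center of $B_n$ equals the cyclic subgroup $\langle\Delta^2\rangle$ generated by the full twist $\Delta^2$, and this subgroup is infinite (that is, $\Delta^2$ has infinite order). -/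

import Mathlib

/-- The relators `u * v⁻¹` of Artin's presentation, one for each relation `u = v`.
The generator with index `i : Fin (n - 1)` is the standard generator `σ_{i+1}`. -/
def braidRels (n : ℕ) : Set (FreeGroup (Fin (n - 1))) :=
  {r | ∃ i j : Fin (n - 1), (i : ℕ) + 1 < j ∧
      r = (FreeGroup.of i * FreeGroup.of j) * (FreeGroup.of j * FreeGroup.of i)⁻¹} ∪
  {r | ∃ i j : Fin (n - 1), (i : ℕ) + 1 = j ∧
      r = (FreeGroup.of i * FreeGroup.of j * FreeGroup.of i) *
        (FreeGroup.of j * FreeGroup.of i * FreeGroup.of j)⁻¹}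

/-- The braid group `B_n` on `n` strands, given by Artin's presentation: generators
`σ_1, …, σ_{n-1}`, relations `σ_i σ_j = σ_j σ_i` for `|i - j| > 1` and
`σ_i σ_j σ_i = σ_j σ_i σ_j` for `|i - j| = 1`. -/
abbrev BraidGroup (n : ℕ) : Type := PresentedGroup (braidRels n)

namespace BraidGroup

/-- The standard generators; `σ i` is the generator written `σ_{i+1}` in the usual numbering. -/
def σ {n : ℕ} (i : Fin (n - 1)) : BraidGroup n := PresentedGroup.of i

/-- The descending product `σ_{k+1} σ_k ⋯ σ_1` (usual numbering from `1`). -/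
def descending {n : ℕ} (k : Fin (n - 1)) : BraidGroup n :=
  (List.ofFn fun j : Fin ((k : ℕ) + 1) =>
    (σ ⟨(k : ℕ) - (j : ℕ), lt_of_le_of_lt (Nat.sub_le _ _) k.isLt⟩ : BraidGroup n)).prod

/-- The half twist `Δ = σ_1 (σ_2 σ_1) ⋯ (σ_{n-1} σ_{n-2} ⋯ σ_1)`. -/
def Δ (n : ℕ) : BraidGroup n :=
  (List.ofFn fun k : Fin (n - 1) => (descending k : BraidGroup n)).prod

end BraidGroup

/-! Garside's argument passes to the monoid of positive braids, where word length is well defined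
and divisibility can be controlled. Its core is `leadEq_of_gen_mul_eq`: two generators dividing one
element on the left force their least common multiple to divide it. This gives left cancellation and
shows that `Δ` is the least common multiple of all generators (`dvd_halfTwist`, `halfTwist_dvd`).

Conjugation by `Δ` reverses the generators, so `Δ²` is central. Conversely, a nontrivial central
positive braid is divisible by one generator, hence by all since the graph is connected, hence by
`Δ`. The quotient is central only up to relabelling generators, which is why
`eq_Δ_pow_of_quasiCentral` allows a relabelling. Odd powers of `Δ` are excluded since reversal moves
the first generator.

Inverting the central `Δ²` makes every generator a unit, so positive braids embed in `B_n`
(`ofPositive_injective`). Every braid is a power of `Δ²` times a positive braid, which reduces the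
center to the positive case; length gives infinite order. -/

/-! ### Simply laced Artin monoids and word length. -/

/-- The defining relations of the Artin monoid of a simply laced Coxeter graph: adjacent generators
satisfy the braid relation, distinct non-adjacent generators commute. -/
inductive artinRels {ι : Type*} (G : SimpleGraph ι) : FreeMonoid ι → FreeMonoid ι → Prop
  | comm (i j : ι) (hne : i ≠ j) (h : ¬ G.Adj i j) : artinRels G
      (FreeMonoid.of i * FreeMonoid.of j) (FreeMonoid.of j * FreeMonoid.of i)
  | braid (i j : ι) (h : G.Adj i j) : artinRels G
      (FreeMonoid.of i * (FreeMonoid.of j * FreeMonoid.of i))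
      (FreeMonoid.of j * (FreeMonoid.of i * FreeMonoid.of j))

/-- The Artin monoid of a simply laced Coxeter graph. -/
abbrev ArtinMonoid {ι : Type*} (G : SimpleGraph ι) : Type _ := PresentedMonoid (artinRels G)

namespace ArtinMonoid

variable {ι : Type*} {G : SimpleGraph ι}

/-- The standard generators of the Artin monoid. -/
def gen (G : SimpleGraph ι) (i : ι) : ArtinMonoid G := PresentedMonoid.of _ i

theorem gen_comm {i j : ι} (hne : i ≠ j) (h : ¬ G.Adj i j) :
    gen G i * gen G j = gen G j * gen G i :=
  PresentedMonoid.mk_eq_mk_of_rel (.comm i j hne h)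

theorem gen_comm_assoc {i j : ι} (hne : i ≠ j) (h : ¬ G.Adj i j) (x : ArtinMonoid G) :
    gen G i * (gen G j * x) = gen G j * (gen G i * x) := by
  rw [← mul_assoc, gen_comm hne h, mul_assoc]

theorem gen_braid {i j : ι} (h : G.Adj i j) :
    gen G i * (gen G j * gen G i) = gen G j * (gen G i * gen G j) :=
  PresentedMonoid.mk_eq_mk_of_rel (.braid i j h)

theorem gen_braid_assoc {i j : ι} (h : G.Adj i j) (x : ArtinMonoid G) :
    gen G i * (gen G j * (gen G i * x)) = gen G j * (gen G i * (gen G j * x)) := by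
  have := congrArg (· * x) (gen_braid h)
  simpa only [mul_assoc] using this

/-- The word length, as a homomorphism. -/
def lengthHom (G : SimpleGraph ι) : ArtinMonoid G →* Multiplicative ℕ :=
  PresentedMonoid.lift (fun _ => Multiplicative.ofAdd 1) (by
    rintro _ _ (⟨i, j, _, _⟩ | ⟨i, j, _⟩) <;> rfl)

/-- The word length of an element of the Artin monoid. -/
def length (x : ArtinMonoid G) : ℕ := (lengthHom G x).toAdd

@[simp] theorem length_one : length (1 : ArtinMonoid G) = 0 := rfl

@[simp] theorem length_gen (i : ι) : length (gen G i) = 1 := rfl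

@[simp] theorem length_mul (x y : ArtinMonoid G) : length (x * y) = length x + length y := by
  simp [length]

@[simp] theorem length_pow (x : ArtinMonoid G) (k : ℕ) : length (x ^ k) = k * length x := by
  simp [length]

theorem eq_one_or_eq_gen_mul (x : ArtinMonoid G) : x = 1 ∨ ∃ i y, x = gen G i * y := by
  obtain ⟨a, rfl⟩ := PresentedMonoid.surjective_mk x
  cases a using FreeMonoid.casesOn with
  | one => exact .inl rfl
  | of_mul i a => exact .inr ⟨i, PresentedMonoid.mk _ a, rfl⟩

theorem induction_gen {p : ArtinMonoid G → Prop} (one : p 1)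
    (gen_mul : ∀ i x, p x → p (gen G i * x)) (x : ArtinMonoid G) : p x := by
  obtain ⟨a, rfl⟩ := PresentedMonoid.surjective_mk x
  induction a using FreeMonoid.inductionOn' with
  | one => exact one
  | of_mul i a ih => exact gen_mul i _ ih

/-! ### Garside's lemma on common multiples of two generators, and left cancellation. -/

/-- The way in which `gen i * x` and `gen j * y` should agree: they are literally equal, or they
are multiples of the least common multiple of `gen i` and `gen j` with the same cofactor. -/
def LeadEq (i : ι) (x : ArtinMonoid G) (j : ι) (y : ArtinMonoid G) : Prop :=
  (i = j ∧ x = y) ∨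
  (G.Adj i j ∧ ∃ z, x = gen G j * (gen G i * z) ∧ y = gen G i * (gen G j * z)) ∨
  (i ≠ j ∧ ¬ G.Adj i j ∧ ∃ z, x = gen G j * z ∧ y = gen G i * z)

namespace LeadEq

variable {i j k : ι} {x y w : ArtinMonoid G}

theorem symm (h : LeadEq i x j y) : LeadEq j y i x := by
  rcases h with ⟨rfl, rfl⟩ | ⟨h, z, rfl, rfl⟩ | ⟨hne, h, z, rfl, rfl⟩
  · exact .inl ⟨rfl, rfl⟩
  · exact .inr (.inl ⟨h.symm, z, rfl, rfl⟩)
  · exact .inr (.inr ⟨hne.symm, fun h' => h h'.symm, z, rfl, rfl⟩)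

theorem mul_right (h : LeadEq i x j y) (w : ArtinMonoid G) : LeadEq i (x * w) j (y * w) := by
  rcases h with ⟨rfl, rfl⟩ | ⟨h, z, rfl, rfl⟩ | ⟨hne, h, z, rfl, rfl⟩
  · exact .inl ⟨rfl, rfl⟩
  · exact .inr (.inl ⟨h, z * w, by simp only [mul_assoc], by simp only [mul_assoc]⟩)
  · exact .inr (.inr ⟨hne, h, z * w, by simp only [mul_assoc], by simp only [mul_assoc]⟩)

theorem eq_right (h : LeadEq i x i y) : x = y := by
  rcases h with ⟨_, rfl⟩ | ⟨h, _⟩ | ⟨h, _⟩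
  · rfl
  · exact absurd h G.irrefl
  · exact absurd rfl h

theorem of_adj (h : LeadEq i x j y) (hij : G.Adj i j) :
    ∃ z, x = gen G j * (gen G i * z) ∧ y = gen G i * (gen G j * z) := by
  rcases h with ⟨rfl, _⟩ | ⟨_, h⟩ | ⟨_, h, _⟩
  · exact absurd hij G.irrefl
  · exact h
  · exact absurd hij h

theorem of_not_adj (h : LeadEq i x j y) (hne : i ≠ j) (hij : ¬ G.Adj i j) :
    ∃ z, x = gen G j * z ∧ y = gen G i * z := by
  rcases h with ⟨h, _⟩ | ⟨h, _⟩ | ⟨_, _, h⟩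
  · exact absurd h hne
  · exact absurd h hij
  · exact h

/-- The mixed case of transitivity: `i` is adjacent to `j`, and `j` commutes with `k`. -/
theorem trans_adj_comm {L : ℕ}
    (ih : ∀ (i j : ι) (x y : ArtinMonoid G), length x < L →
      gen G i * x = gen G j * y → LeadEq i x j y)
    {z z' : ArtinMonoid G} (hz : length z + 2 ≤ L) (hij : G.Adj i j) (hjk : j ≠ k)
    (hjk' : ¬ G.Adj j k) (h : gen G i * (gen G j * z) = gen G k * z') :
    LeadEq i (gen G j * (gen G i * z)) k (gen G j * z') := by
  have hik : i ≠ k := fun h => hjk' (h ▸ hij.symm)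
  have hkj : ¬ G.Adj k j := fun h => hjk' h.symm
  have h1 := ih _ _ _ _ (by simp; omega) h
  by_cases hik' : G.Adj i k
  · obtain ⟨v, hv, rfl⟩ := h1.of_adj hik'
    have hl := congrArg length hv
    simp at hl
    obtain ⟨u, rfl, hu⟩ := (ih _ _ _ _ (by omega) hv).of_not_adj hjk hjk'
    simp at hz hl
    obtain ⟨t, rfl, rfl⟩ := (ih _ _ _ _ (by omega) hu).of_adj hij
    refine .inr (.inl ⟨hik', gen G j * (gen G i * (gen G k * t)), ?_, ?_⟩)
    · rw [gen_braid_assoc hik', gen_comm_assoc hjk hjk', gen_comm_assoc hjk.symm hkj t,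
        gen_braid_assoc hij.symm]
    · rw [gen_comm_assoc hjk.symm hkj (gen G i * t), gen_braid_assoc hij.symm,
        gen_braid_assoc hik', gen_comm_assoc hjk hjk']
  · obtain ⟨v, hv, rfl⟩ := h1.of_not_adj hik hik'
    obtain ⟨u, rfl, rfl⟩ := (ih _ _ _ _ (by omega) hv).of_not_adj hjk hjk'
    refine .inr (.inr ⟨hik, hik', gen G j * (gen G i * u), ?_, ?_⟩)
    · rw [gen_comm_assoc hik hik', gen_comm_assoc hjk hjk']
    · rw [gen_braid_assoc hij.symm]

/-- The middle element has two prescribed leading forms, and comparing them is an equation one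
letter shorter, to which `ih` applies. Without triangles, three distinct generators span only finite
types, so the comparison always closes up. -/
theorem trans {L : ℕ} (tri : ∀ i j k, G.Adj i j → G.Adj j k → ¬ G.Adj i k)
    (ih : ∀ (i j : ι) (x y : ArtinMonoid G), length x < L →
      gen G i * x = gen G j * y → LeadEq i x j y)
    (hx : length x ≤ L) (h₁ : LeadEq i x j y) (h₂ : LeadEq j y k w) : LeadEq i x k w := by
  rcases h₁ with ⟨rfl, rfl⟩ | ⟨hij, z, rfl, rfl⟩ | ⟨hij, hij', z, rfl, rfl⟩
  · exact h₂
  · simp at hx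
    rcases h₂ with ⟨rfl, rfl⟩ | ⟨hjk, z', h, rfl⟩ | ⟨hjk, hjk', z', h, rfl⟩
    · exact .inr (.inl ⟨hij, z, rfl, rfl⟩)
    · have h1 := ih _ _ _ _ (by simp; omega) h
      by_cases hik : i = k
      · subst hik
        have h2 := (ih _ _ _ _ (by omega) h1.eq_right).eq_right
        exact .inl ⟨rfl, by rw [h2]⟩
      · have hik' := tri _ _ _ hij hjk
        obtain ⟨v, hv, hv'⟩ := h1.of_not_adj hik hik'
        have hl := congrArg length h
        simp at hl
        obtain ⟨u, rfl, rfl⟩ := (ih _ _ _ _ (by omega) hv).of_adj hjk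
        simp at hx hl
        obtain ⟨t, rfl, ht⟩ := (ih _ _ _ _ (by omega) hv').of_adj hij.symm
        have ht' := (ih _ _ _ _ (by simp; omega) ht).eq_right
        simp at hl
        obtain ⟨s, rfl, rfl⟩ := (ih _ _ _ _ (by omega) ht').of_not_adj (Ne.symm hik)
          (fun h => hik' h.symm)
        -- Here `i`, `j`, `k` form a path, and the common element is the six-letter half twist of
        -- that path times `s`.
        refine .inr (.inr ⟨hik, hik', gen G j * (gen G k * (gen G i * (gen G j * s))), ?_, ?_⟩)
        · rw [gen_comm_assoc hik hik', gen_braid_assoc hij, gen_braid_assoc hjk]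
        · rw [gen_comm_assoc (Ne.symm hik) (fun h => hik' h.symm) (gen G j * _),
            gen_braid_assoc hjk.symm, gen_braid_assoc hij.symm, gen_comm_assoc hik hik']
    · exact trans_adj_comm ih (by omega) hij hjk hjk' h
  · simp at hx
    rcases h₂ with ⟨rfl, rfl⟩ | ⟨hjk, z', h, rfl⟩ | ⟨hjk, hjk', z', h, rfl⟩
    · exact .inr (.inr ⟨hij, hij', z, rfl, rfl⟩)
    · have hl := congrArg length h
      simp at hl
      exact (trans_adj_comm ih (by omega) hjk.symm (Ne.symm hij) (fun h => hij' h.symm) h.symm).symm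
    · have h1 := ih _ _ _ _ (by omega) h
      rcases h1 with ⟨rfl, rfl⟩ | ⟨hik, v, rfl, rfl⟩ | ⟨hik, hik', v, rfl, rfl⟩
      · exact .inl ⟨rfl, rfl⟩
      · refine .inr (.inl ⟨hik, gen G j * v, ?_, ?_⟩)
        · rw [gen_comm_assoc hjk hjk', gen_comm_assoc (Ne.symm hij) (fun h => hij' h.symm)]
        · rw [gen_comm_assoc (Ne.symm hij) (fun h => hij' h.symm), gen_comm_assoc hjk hjk']
      · refine .inr (.inr ⟨hik, hik', gen G j * v, ?_, ?_⟩)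
        · rw [gen_comm_assoc hjk hjk']
        · rw [gen_comm_assoc (Ne.symm hij) (fun h => hij' h.symm)]

end LeadEq

theorem of_mul_inj {i j : ι} {u v : FreeMonoid ι}
    (h : FreeMonoid.of i * u = FreeMonoid.of j * v) : i = j ∧ u = v :=
  List.cons.inj h

theorem mk_of_mul (i : ι) (u : FreeMonoid ι) :
    PresentedMonoid.mk (artinRels G) (FreeMonoid.of i * u) =
      gen G i * PresentedMonoid.mk (artinRels G) u := rfl

/-- Induction on length, then on the derivation that the two words are congruent. Only transitivity
is hard, and it uses shorter instances of the statement itself. -/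
theorem leadEq_of_gen_mul_eq (tri : ∀ i j k, G.Adj i j → G.Adj j k → ¬ G.Adj i k) {i j : ι}
    {x y : ArtinMonoid G} (h : gen G i * x = gen G j * y) : LeadEq i x j y := by
  suffices H : ∀ (L : ℕ) (i j : ι) (x y : ArtinMonoid G), length x < L →
      gen G i * x = gen G j * y → LeadEq i x j y from H _ i j x y (Nat.lt_succ_self _) h
  clear h x y i j
  intro L
  induction L with
  | zero => intro i j x y h; omega
  | succ L ih =>
    have key : ∀ u v : FreeMonoid ι, ConGen.Rel (artinRels G) u v →
        PresentedMonoid.mk (artinRels G) u = PresentedMonoid.mk (artinRels G) v ∧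
        (length (PresentedMonoid.mk (artinRels G) u) ≤ L + 1 → (u = 1 ∧ v = 1) ∨
          ∃ i u' j v', u = FreeMonoid.of i * u' ∧ v = FreeMonoid.of j * v' ∧
            LeadEq i (PresentedMonoid.mk (artinRels G) u') j
              (PresentedMonoid.mk (artinRels G) v')) := by
      intro u v h
      refine ⟨PresentedMonoid.mk_eq_mk_iff.2 h, ?_⟩
      induction h with
      | of u v h =>
        intro _
        rcases h with ⟨i, j, hne, h⟩ | ⟨i, j, h⟩
        · exact .inr ⟨i, _, j, _, rfl, rfl, .inr (.inr ⟨hne, h, 1, rfl, rfl⟩)⟩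
        · exact .inr ⟨i, _, j, _, rfl, rfl, .inr (.inl ⟨h, 1, rfl, rfl⟩)⟩
      | refl u =>
        intro _
        cases u using FreeMonoid.casesOn with
        | one => exact .inl ⟨rfl, rfl⟩
        | of_mul i u => exact .inr ⟨i, u, i, u, rfl, rfl, .inl ⟨rfl, rfl⟩⟩
      | @symm u v h IH =>
        intro hl
        rw [← PresentedMonoid.mk_eq_mk_iff.2 h] at hl
        rcases IH hl with ⟨rfl, rfl⟩ | ⟨i, u', j, v', rfl, rfl, H⟩
        · exact .inl ⟨rfl, rfl⟩
        · exact .inr ⟨j, v', i, u', rfl, rfl, H.symm⟩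
      | @trans u v w h h' IH IH' =>
        intro hl
        have hl' := hl
        rw [PresentedMonoid.mk_eq_mk_iff.2 h] at hl'
        rcases IH hl with ⟨rfl, rfl⟩ | ⟨i, u', j, v', rfl, rfl, H⟩
        · exact IH' hl'
        · rcases IH' hl' with ⟨h, _⟩ | ⟨j', v'', k, w', hv, rfl, H'⟩
          · exact absurd h (List.cons_ne_nil _ _)
          · obtain ⟨rfl, rfl⟩ := of_mul_inj hv
            rw [mk_of_mul, length_mul, length_gen] at hl
            exact .inr ⟨i, u', k, w', rfl, rfl, H.trans tri ih (by omega) H'⟩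
      | @mul u v u₁ v₁ h h' IH IH' =>
        intro hl
        rw [map_mul, length_mul] at hl
        rcases IH (by omega) with ⟨rfl, rfl⟩ | ⟨i, u', j, v', rfl, rfl, H⟩
        · rw [one_mul, one_mul]
          exact IH' (by omega)
        · refine .inr ⟨i, u' * u₁, j, v' * v₁, mul_assoc _ _ _, mul_assoc _ _ _, ?_⟩
          rw [map_mul, map_mul, ← PresentedMonoid.mk_eq_mk_iff.2 h']
          exact H.mul_right _
    intro i j x y hl h
    obtain ⟨u, rfl⟩ := PresentedMonoid.surjective_mk x
    obtain ⟨v, rfl⟩ := PresentedMonoid.surjective_mk y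
    rw [← mk_of_mul, ← mk_of_mul, PresentedMonoid.mk_eq_mk_iff] at h
    rcases (key _ _ h).2 (by rw [mk_of_mul, length_mul, length_gen]; omega) with
      ⟨h, _⟩ | ⟨i', u', j', v', hu, hv, H⟩
    · exact absurd h (List.cons_ne_nil _ _)
    · obtain ⟨rfl, rfl⟩ := of_mul_inj hu
      obtain ⟨rfl, rfl⟩ := of_mul_inj hv
      exact H

theorem mul_left_cancel (tri : ∀ i j k, G.Adj i j → G.Adj j k → ¬ G.Adj i k)
    (a : ArtinMonoid G) : ∀ {x y : ArtinMonoid G}, a * x = a * y → x = y := by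
  induction a using induction_gen with
  | one => intro x y h; simpa using h
  | gen_mul i a ih =>
    intro x y h
    rw [mul_assoc, mul_assoc] at h
    exact ih (leadEq_of_gen_mul_eq tri h).eq_right

theorem gen_injective (tri : ∀ i j k, G.Adj i j → G.Adj j k → ¬ G.Adj i k) :
    Function.Injective (gen G) := by
  intro i j h
  rcases leadEq_of_gen_mul_eq tri (congrArg (· * 1) h) with ⟨h, _⟩ | ⟨_, z, h, _⟩ | ⟨_, _, z, h, _⟩
  · exact h
  · have := congrArg length h
    simp only [length_one, length_mul, length_gen] at this
    omega
  · have := congrArg length h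
    simp only [length_one, length_mul, length_gen] at this
    omega

/-- In a connected Artin monoid, an element that commutes with the generators up to relabelling is
divisible by all generators as soon as it is divisible by one. -/
theorem gen_dvd_of_quasiCentral (tri : ∀ i j k, G.Adj i j → G.Adj j k → ¬ G.Adj i k)
    (conn : G.Preconnected) {q : ArtinMonoid G} {e : ι → ι}
    (hq : ∀ i, gen G i * q = q * gen G (e i)) {i : ι} (hi : gen G i ∣ q) (j : ι) :
    gen G j ∣ q := by
  obtain ⟨p⟩ := conn i j
  induction p with
  | nil => exact hi
  | @cons i j k h p ih =>
    refine ih ?_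
    obtain ⟨r, rfl⟩ := hi
    have h1 := hq j
    rw [mul_assoc] at h1
    -- The element `q` begins with `gen i * gen j`; cancelling `gen i` in the relation for `i`
    -- leaves `q` beginning with `gen j`.
    obtain ⟨z, -, hz⟩ := (leadEq_of_gen_mul_eq tri h1.symm).of_adj h
    have h2 := hq i
    nth_rewrite 2 [hz] at h2
    rw [mul_assoc, mul_assoc] at h2
    exact ⟨_, mul_left_cancel tri _ h2⟩

end ArtinMonoid

/-! ### Half twist identities from the braid relations alone. -/

/-- The elements `s 0, …, s (m - 1)` of a monoid satisfy the relations of Artin's presentation. -/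
structure IsBraidSeq {M : Type*} [Monoid M] (s : ℕ → M) (m : ℕ) : Prop where
  comm : ∀ i j, i + 1 < j → j < m → s i * s j = s j * s i
  braid : ∀ i, i + 1 < m → s i * s (i + 1) * s i = s (i + 1) * s i * s (i + 1)

/-- The descending product `s (k - 1) * ⋯ * s 0`. -/
def descProd {M : Type*} [Monoid M] (s : ℕ → M) : ℕ → M
  | 0 => 1
  | k + 1 => s k * descProd s k

/-- The half twist `s 0 * (s 1 * s 0) * ⋯ * (s (k - 1) * ⋯ * s 0)`. -/
def halfTwist {M : Type*} [Monoid M] (s : ℕ → M) : ℕ → M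
  | 0 => 1
  | k + 1 => halfTwist s k * descProd s (k + 1)

theorem map_descProd {M N : Type*} [Monoid M] [Monoid N] (f : M →* N) (s : ℕ → M) (k : ℕ) :
    f (descProd s k) = descProd (fun i => f (s i)) k := by
  induction k with
  | zero => exact map_one f
  | succ k ih => rw [descProd, map_mul, ih]; rfl

theorem map_halfTwist {M N : Type*} [Monoid M] [Monoid N] (f : M →* N) (s : ℕ → M) (k : ℕ) :
    f (halfTwist s k) = halfTwist (fun i => f (s i)) k := by
  induction k with
  | zero => exact map_one f
  | succ k ih => rw [halfTwist, map_mul, ih, map_descProd]; rfl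

theorem descProd_eq_prod_ofFn {M : Type*} [Monoid M] (s : ℕ → M) (k : ℕ) :
    descProd s (k + 1) = (List.ofFn fun j : Fin (k + 1) => s (k - j)).prod := by
  induction k with
  | zero => simp [descProd]
  | succ k ih =>
    rw [descProd, ih, List.ofFn_succ, List.prod_cons]
    simp

theorem halfTwist_eq_prod_ofFn {M : Type*} [Monoid M] (s : ℕ → M) (k : ℕ) :
    halfTwist s k = (List.ofFn fun j : Fin k => descProd s (j + 1)).prod := by
  induction k with
  | zero => simp [halfTwist]
  | succ k ih =>
    rw [halfTwist, ih, List.ofFn_succ', List.concat_eq_append, List.prod_append]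
    simp

namespace IsBraidSeq

variable {M : Type*} [Monoid M] {s : ℕ → M} {m : ℕ}

theorem commute_descProd (h : IsBraidSeq s m) {j k : ℕ} (hk : k < j) (hj : j < m) :
    Commute (s j) (descProd s k) := by
  induction k with
  | zero => exact Commute.one_right _
  | succ k ih => exact Commute.mul_right (h.comm k j hk hj).symm (ih (by omega))

theorem commute_halfTwist (h : IsBraidSeq s m) {j k : ℕ} (hk : k < j) (hj : j < m) :
    Commute (s j) (halfTwist s k) := by
  induction k with
  | zero => exact Commute.one_right _
  | succ k ih => exact Commute.mul_right (ih (by omega)) (h.commute_descProd hk hj)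

/-- The letter moves left past smaller letters until it meets `s (j + 1) * s j`, where one braid
relation lowers its index; it then passes the larger letters. -/
theorem descProd_mul_succ (h : IsBraidSeq s m) {j k : ℕ} (hj : j + 1 < k) (hk : k ≤ m) :
    descProd s k * s (j + 1) = s j * descProd s k := by
  induction k with
  | zero => omega
  | succ k ih =>
    rcases Nat.lt_or_ge (j + 1) k with hjk | hjk
    · rw [descProd, mul_assoc, ih hjk (by omega), ← mul_assoc, ← mul_assoc,
        h.comm j k hjk (by omega)]
    · obtain rfl : k = j + 1 := by omega
      rw [descProd, descProd, mul_assoc, mul_assoc,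
        ← (h.commute_descProd (Nat.lt_succ_self j) (by omega)).eq, ← mul_assoc (s j),
        ← mul_assoc, ← mul_assoc, ← h.braid j (by omega)]
      simp only [mul_assoc]

/-- Each letter of the second factor drops by one in passing the first, except the final `s 0`,
which has nowhere to go. -/
theorem descProd_mul_descProd (h : IsBraidSeq s m) {j k : ℕ} (hj : j ≤ k) (hk : k < m) :
    descProd s (k + 1) * descProd s (j + 1) = descProd s j * (descProd s (k + 1) * s 0) := by
  induction j with
  | zero => simp [descProd]
  | succ j ih =>
    change descProd s (k + 1) * (s (j + 1) * descProd s (j + 1)) = _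
    rw [← mul_assoc, h.descProd_mul_succ (by omega) (by omega), mul_assoc,
      ih (by omega), ← mul_assoc]
    rfl

theorem descProd_dvd (h : IsBraidSeq s m) {j k : ℕ} (hj : j ≤ k) (hk : k < m) :
    descProd s (k + 1) ∣ descProd s j * descProd s (k + 1) := by
  induction j with
  | zero => simp [descProd]
  | succ j ih =>
    obtain ⟨e, he⟩ := ih (by omega)
    refine ⟨s (j + 1) * e, ?_⟩
    rw [← mul_assoc, h.descProd_mul_succ (by omega) (by omega), mul_assoc, ← he, ← mul_assoc]
    rfl

/-- For `i < k` the new factor `descProd s (k + 1)` shifts the reversed index by one. The top letter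
instead commutes with `halfTwist s (k - 1)` and is absorbed by `descProd_mul_descProd`. -/
theorem mul_halfTwist (h : IsBraidSeq s m) {i k : ℕ} (hi : i < k) (hk : k ≤ m) :
    s i * halfTwist s k = halfTwist s k * s (k - 1 - i) := by
  induction k with
  | zero => omega
  | succ k ih =>
    rcases Nat.lt_or_ge i k with hik | hik
    · obtain ⟨d, hd⟩ : ∃ d, k - 1 - i = d := ⟨_, rfl⟩
      rw [halfTwist, ← mul_assoc, ih hik (by omega), hd, mul_assoc, mul_assoc,
        ← h.descProd_mul_succ (by omega) hk]
      congr 3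
      omega
    · obtain rfl : i = k := by omega
      cases i with
      | zero => simp [halfTwist, descProd]
      | succ i =>
        have h1 := h.descProd_mul_descProd (Nat.le_refl (i + 1)) (by omega)
        have h2 : s (i + 1) * (descProd s (i + 1) * descProd s (i + 1 + 1)) =
            descProd s (i + 1) * (descProd s (i + 1 + 1) * s 0) := by
          rw [← h1, ← mul_assoc]; rfl
        rw [halfTwist, halfTwist, ← mul_assoc, ← mul_assoc,
          (h.commute_halfTwist (Nat.lt_succ_self i) (by omega)).eq]
        simp only [mul_assoc]
        rw [h2]
        simp

theorem dvd_halfTwist (h : IsBraidSeq s m) {i k : ℕ} (hi : i < k) (hk : k ≤ m) :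
    s i ∣ halfTwist s k := by
  induction k with
  | zero => omega
  | succ k ih =>
    rcases Nat.lt_or_ge i k with hik | hik
    · exact dvd_mul_of_dvd_left (ih hik (by omega)) _
    · obtain rfl : i = k := by omega
      cases i with
      | zero => simp [halfTwist, descProd]
      | succ i =>
        obtain ⟨e, he⟩ := h.descProd_dvd (Nat.le_refl (i + 1)) (by omega)
        refine ⟨halfTwist s i * (descProd s (i + 1) * e), ?_⟩
        rw [halfTwist, halfTwist, mul_assoc, he, ← mul_assoc (s (i + 1)),
          (h.commute_halfTwist (Nat.lt_succ_self i) (by omega)).eq]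
        simp only [descProd, mul_assoc]

theorem commute_halfTwist_sq (h : IsBraidSeq s m) {i : ℕ} (hi : i < m) :
    Commute (s i) (halfTwist s m ^ 2) := by
  have h1 := h.mul_halfTwist hi le_rfl
  have h2 := h.mul_halfTwist (i := m - 1 - i) (by omega) le_rfl
  rw [show m - 1 - (m - 1 - i) = i by omega] at h2
  rw [Commute, SemiconjBy, pow_two, ← mul_assoc, h1, mul_assoc, h2, mul_assoc]

end IsBraidSeq

/-! ### The half twist as a least common multiple. -/

/-- Braid sequences in which divisibility behaves as in Garside's lemma. -/
structure IsGarsideSeq {M : Type*} [Monoid M] (s : ℕ → M) (m : ℕ) : Prop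
    extends IsBraidSeq s m where
  cancel : ∀ a x y : M, a * x = a * y → x = y
  dvd_of_far : ∀ i j x, i + 1 < j → j < m → s j ∣ s i * x → s j ∣ x
  dvd_of_near : ∀ i x, i + 1 < m → s (i + 1) ∣ s i * x → s (i + 1) * s i ∣ x

namespace IsGarsideSeq

variable {M : Type*} [Monoid M] {s : ℕ → M} {m : ℕ}

theorem dvd_of_dvd_descProd_mul (h : IsGarsideSeq s m) {j k : ℕ} (hk : k < j) (hj : j < m)
    {x : M} (hx : s j ∣ descProd s k * x) : s j ∣ x := by
  induction k with
  | zero => simpa [descProd] using hx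
  | succ k ih =>
    rw [descProd, mul_assoc] at hx
    exact ih (by omega) (h.dvd_of_far _ _ _ hk hj hx)

theorem dvd_of_dvd_halfTwist_mul (h : IsGarsideSeq s m) {j k : ℕ} (hk : k < j) (hj : j < m)
    {x : M} (hx : s j ∣ halfTwist s k * x) : s j ∣ x := by
  induction k generalizing x with
  | zero => simpa [halfTwist] using hx
  | succ k ih =>
    rw [halfTwist, mul_assoc] at hx
    exact h.dvd_of_dvd_descProd_mul hk hj (ih (by omega) hx)

/-- `dvd_of_near` extracts `s (k + 1) * s k`; the first letter then commutes past the far letters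
and cancels, leaving the same problem one index lower. -/
theorem descProd_succ_dvd (h : IsGarsideSeq s m) {k : ℕ} (hk : k < m) {x : M}
    (hx : s k ∣ descProd s k * x) : descProd s (k + 1) ∣ x := by
  induction k generalizing x with
  | zero => simpa [descProd] using hx
  | succ k ih =>
    rw [descProd, mul_assoc] at hx
    obtain ⟨c, hc⟩ := h.dvd_of_near _ _ hk hx
    rw [mul_assoc] at hc
    obtain ⟨y, rfl⟩ := h.dvd_of_dvd_descProd_mul (Nat.lt_succ_self k) hk ⟨_, hc⟩
    rw [← mul_assoc, ← (h.commute_descProd (Nat.lt_succ_self k) hk).eq, mul_assoc] at hc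
    exact mul_dvd_mul_left _ (ih (by omega) ⟨c, h.cancel _ _ _ hc⟩)

theorem halfTwist_dvd (h : IsGarsideSeq s m) {k : ℕ} (hk : k ≤ m) {x : M}
    (hx : ∀ i < k, s i ∣ x) : halfTwist s k ∣ x := by
  induction k with
  | zero => exact one_dvd x
  | succ k ih =>
    obtain ⟨q, rfl⟩ := ih (by omega) fun i hi => hx i (by omega)
    refine mul_dvd_mul_left _ (h.descProd_succ_dvd hk ?_)
    have hk' := hx k (Nat.lt_succ_self k)
    cases k with
    | zero => simpa [descProd, halfTwist] using hk'
    | succ k =>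
      rw [halfTwist, mul_assoc] at hk'
      exact h.dvd_of_dvd_halfTwist_mul (Nat.lt_succ_self k) hk hk'

end IsGarsideSeq

/-! ### Quasi-central positive braids. -/

/-- The positive braid monoid with generators indexed by `Fin m`. -/
abbrev PositiveBraidMonoid (m : ℕ) : Type := ArtinMonoid (SimpleGraph.pathGraph m)

namespace PositiveBraidMonoid

open ArtinMonoid

variable {m : ℕ}

/-- The generators, extended by `1` to all natural indices. -/
def s (m i : ℕ) : PositiveBraidMonoid m :=
  if h : i < m then gen (SimpleGraph.pathGraph m) ⟨i, h⟩ else 1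

theorem s_of_lt {i : ℕ} (h : i < m) : s m i = gen (SimpleGraph.pathGraph m) ⟨i, h⟩ := dif_pos h

theorem s_val (i : Fin m) : s m i = gen (SimpleGraph.pathGraph m) i := dif_pos i.isLt

theorem pathGraph_triangleFree (i j k : Fin m) (hij : (SimpleGraph.pathGraph m).Adj i j)
    (hjk : (SimpleGraph.pathGraph m).Adj j k) : ¬ (SimpleGraph.pathGraph m).Adj i k := by
  simp only [SimpleGraph.pathGraph_adj] at *
  omega

theorem isGarsideSeq (m : ℕ) : IsGarsideSeq (s m) m where
  comm i j hij hj := by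
    rw [s_of_lt hj, s_of_lt (show i < m by omega)]
    exact gen_comm (by simp; omega) (by simp [SimpleGraph.pathGraph_adj]; omega)
  braid i hi := by
    rw [s_of_lt hi, s_of_lt (show i < m by omega), mul_assoc, mul_assoc]
    exact gen_braid (by simp [SimpleGraph.pathGraph_adj])
  cancel a _ _ := mul_left_cancel pathGraph_triangleFree a
  dvd_of_far i j x hij hj := by
    rw [s_of_lt hj, s_of_lt (show i < m by omega)]
    rintro ⟨y, hy⟩
    obtain ⟨z, rfl, -⟩ := (leadEq_of_gen_mul_eq pathGraph_triangleFree hy).of_not_adj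
      (by simp; omega) (by simp [SimpleGraph.pathGraph_adj]; omega)
    exact dvd_mul_right _ _
  dvd_of_near i x hi := by
    rw [s_of_lt hi, s_of_lt (show i < m by omega)]
    rintro ⟨y, hy⟩
    obtain ⟨z, rfl, -⟩ := (leadEq_of_gen_mul_eq pathGraph_triangleFree hy).of_adj
      (by simp [SimpleGraph.pathGraph_adj])
    rw [← mul_assoc]
    exact dvd_mul_right _ _

/-- The half twist in the positive braid monoid. -/
def Δ (m : ℕ) : PositiveBraidMonoid m := halfTwist (s m) m

theorem gen_mul_Δ (i : Fin m) : gen _ i * Δ m = Δ m * gen _ i.rev := by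
  have := (isGarsideSeq m).mul_halfTwist i.isLt le_rfl
  rwa [s_val, show m - 1 - (i : ℕ) = (i.rev : ℕ) by rw [Fin.val_rev]; omega, s_val] at this

theorem Δ_mul_gen (i : Fin m) : Δ m * gen _ i = gen _ i.rev * Δ m := by
  rw [gen_mul_Δ, Fin.rev_rev]

theorem commute_Δ_sq (x : PositiveBraidMonoid m) : Commute x (Δ m ^ 2) := by
  induction x using induction_gen with
  | one => exact Commute.one_left _
  | gen_mul i x ih =>
    refine Commute.mul_left ?_ ih
    rw [← s_val]
    exact (isGarsideSeq m).commute_halfTwist_sq i.isLt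

theorem gen_dvd_Δ (i : Fin m) : gen _ i ∣ Δ m := by
  rw [← s_val]
  exact (isGarsideSeq m).dvd_halfTwist i.isLt le_rfl

/-- Elements commuting with the generators up to relabelling are powers of the half twist. -/
theorem eq_Δ_pow_of_quasiCentral (q : PositiveBraidMonoid m) (e : Fin m → Fin m)
    (hq : ∀ i, gen _ i * q = q * gen _ (e i)) : ∃ k : ℕ, q = Δ m ^ k := by
  induction hL : length q using Nat.strong_induction_on generalizing q e with
  | _ L ih =>
    rcases eq_one_or_eq_gen_mul q with rfl | ⟨i, r, rfl⟩
    · exact ⟨0, (pow_zero _).symm⟩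
    · have hall := gen_dvd_of_quasiCentral pathGraph_triangleFree
        (SimpleGraph.pathGraph_preconnected m) hq (dvd_mul_right _ r)
      obtain ⟨q', hq'⟩ := (isGarsideSeq m).halfTwist_dvd le_rfl fun j hj => by
        rw [s_of_lt hj]; exact hall ⟨j, hj⟩
      change _ = Δ m * q' at hq'
      rw [hq'] at hq hL ⊢
      have hpos : 0 < length (Δ m) := by
        obtain ⟨c, hc⟩ := gen_dvd_Δ i
        rw [hc, length_mul, length_gen]
        omega
      rw [length_mul] at hL
      -- Removing `Δ` composes the relabelling with the reversal.
      obtain ⟨k, rfl⟩ := ih (length q') (by omega) q' (fun i => e i.rev) (fun i => by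
        refine mul_left_cancel pathGraph_triangleFree (Δ m) ?_
        rw [← mul_assoc, Δ_mul_gen, mul_assoc, hq, mul_assoc]) rfl
      exact ⟨k + 1, (pow_succ' _ _).symm⟩

theorem eq_Δ_sq_pow_of_central (hm : 1 < m) (q : PositiveBraidMonoid m)
    (hq : ∀ i, gen _ i * q = q * gen _ i) : ∃ k : ℕ, q = (Δ m ^ 2) ^ k := by
  obtain ⟨k, rfl⟩ := eq_Δ_pow_of_quasiCentral q id hq
  rcases Nat.even_or_odd' k with ⟨l, rfl | rfl⟩
  · exact ⟨l, pow_mul _ _ _⟩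
  · exfalso
    have h := hq ⟨0, by omega⟩
    rw [pow_succ, pow_mul, ← mul_assoc, ((commute_Δ_sq _).pow_right l).eq, mul_assoc, mul_assoc,
      gen_mul_Δ] at h
    -- Cancelling the power of `Δ` would identify the first and last generators, which differ since
    -- `1 < m`.
    have h1 := gen_injective pathGraph_triangleFree
      (mul_left_cancel pathGraph_triangleFree _ (mul_left_cancel pathGraph_triangleFree _ h))
    simp [Fin.ext_iff, Fin.val_rev] at h1
    omega

/-! ### Localization at the full twist. -/

/-- The powers of the full twist. -/
abbrev fullTwists (m : ℕ) : Submonoid (PositiveBraidMonoid m) := Submonoid.powers (Δ m ^ 2)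

theorem commute_of_mem_fullTwists (x : PositiveBraidMonoid m) (c : fullTwists m) :
    Commute x (c : PositiveBraidMonoid m) := by
  obtain ⟨k, hk⟩ := c.2
  rw [← hk]
  exact (commute_Δ_sq x).pow_right k

instance (m : ℕ) : OreLocalization.OreSet (fullTwists m) where
  ore_right_cancel r₁ r₂ c h :=
    ⟨c, by rwa [(commute_of_mem_fullTwists r₁ c).eq, (commute_of_mem_fullTwists r₂ c).eq] at h⟩
  oreNum r _ := r
  oreDenom _ c := c
  ore_eq r c := ((commute_of_mem_fullTwists r c).eq).symm

/-- The map to the localization inverting the full twist. -/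
def toLoc (m : ℕ) : PositiveBraidMonoid m →*
    OreLocalization (fullTwists m) (PositiveBraidMonoid m) :=
  OreLocalization.numeratorHom

theorem toLoc_injective : Function.Injective (toLoc m) := by
  intro x y h
  change x /ₒ (1 : fullTwists m) = y /ₒ (1 : fullTwists m) at h
  obtain ⟨u, v, h1, h2⟩ := OreLocalization.oreDiv_eq_iff.1 h
  simp only [OneMemClass.coe_one, mul_one] at h2
  subst h2
  exact (mul_left_cancel pathGraph_triangleFree _ h1).symm

theorem exists_gen_mul_eq_Δ_sq (i : Fin m) :
    ∃ r, gen _ i * r = Δ m ^ 2 ∧ r * gen _ i = Δ m ^ 2 := by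
  obtain ⟨r, hr⟩ := gen_dvd_Δ i
  have h : gen _ i * (r * Δ m) = Δ m ^ 2 := by rw [← mul_assoc, ← hr, pow_two]
  refine ⟨r * Δ m, h, mul_left_cancel pathGraph_triangleFree (gen _ i) ?_⟩
  rw [← mul_assoc, h, (commute_Δ_sq _).eq]

theorem isUnit_toLoc_gen (i : Fin m) : IsUnit (toLoc m (gen _ i)) := by
  obtain ⟨r, h1, h2⟩ := exists_gen_mul_eq_Δ_sq i
  have hu : IsUnit (toLoc m (Δ m ^ 2)) :=
    OreLocalization.numerator_isUnit (⟨_, Submonoid.mem_powers _⟩ : fullTwists m)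
  obtain ⟨a, ha⟩ := (h1 ▸ hu).exists_right_inv
  obtain ⟨b, hb⟩ := (h2 ▸ hu).exists_left_inv
  rw [map_mul] at ha hb
  exact isUnit_iff_exists_and_exists.2
    ⟨⟨_, (mul_assoc _ _ _).symm.trans ha⟩, ⟨_, (mul_assoc _ _ _).trans hb⟩⟩

end PositiveBraidMonoid

/-! ### Embedding positive braids in the braid group, and the center. -/

namespace BraidGroup

open ArtinMonoid PositiveBraidMonoid

variable {n : ℕ}

theorem lift_eq_one_of_braidRels {H : Type*} [Group H] {f : Fin (n - 1) → H}
    (comm : ∀ i j : Fin (n - 1), (i : ℕ) + 1 < j → f i * f j = f j * f i)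
    (braid : ∀ i j : Fin (n - 1), (i : ℕ) + 1 = j → f i * f j * f i = f j * f i * f j) :
    ∀ r ∈ braidRels n, FreeGroup.lift f r = 1 := by
  rintro r (⟨i, j, h, rfl⟩ | ⟨i, j, h, rfl⟩)
  · simp only [map_mul, map_inv, FreeGroup.lift_apply_of]
    exact mul_inv_eq_one.2 (comm i j h)
  · simp only [map_mul, map_inv, FreeGroup.lift_apply_of]
    exact mul_inv_eq_one.2 (braid i j h)

theorem σ_comm (i j : Fin (n - 1)) (h : (i : ℕ) + 1 < j) :
    (σ i * σ j : BraidGroup n) = σ j * σ i :=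
  PresentedGroup.mk_eq_mk_of_mul_inv_mem (.inl ⟨i, j, h, rfl⟩)

theorem σ_braid (i j : Fin (n - 1)) (h : (i : ℕ) + 1 = j) :
    (σ i * σ j * σ i : BraidGroup n) = σ j * σ i * σ j :=
  PresentedGroup.mk_eq_mk_of_mul_inv_mem (.inr ⟨i, j, h, rfl⟩)

/-- The canonical map from positive braids to braids. -/
def ofPositive (n : ℕ) : PositiveBraidMonoid (n - 1) →* BraidGroup n :=
  PresentedMonoid.lift σ (by
    rintro _ _ (⟨i, j, hne, h⟩ | ⟨i, j, h⟩)
    · simp only [map_mul, FreeMonoid.lift_eval_of]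
      rw [SimpleGraph.pathGraph_adj] at h
      rcases Nat.lt_or_gt_of_ne (Fin.val_ne_of_ne hne) with hlt | hlt
      · exact σ_comm i j (by omega)
      · exact (σ_comm j i (by omega)).symm
    · simp only [map_mul, FreeMonoid.lift_eval_of, ← mul_assoc]
      rw [SimpleGraph.pathGraph_adj] at h
      rcases h with h | h
      · exact σ_braid i j h
      · exact (σ_braid j i h).symm)

@[simp] theorem ofPositive_gen (i : Fin (n - 1)) : ofPositive n (gen _ i) = σ i := rfl

theorem ofPositive_Δ (n : ℕ) : ofPositive n (PositiveBraidMonoid.Δ (n - 1)) = Δ n := by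
  rw [PositiveBraidMonoid.Δ, map_halfTwist, halfTwist_eq_prod_ofFn, Δ]
  congr 2
  funext k
  rw [descProd_eq_prod_ofFn, descending]
  congr 2
  funext j
  rw [s_of_lt (show (k : ℕ) - j < n - 1 by omega), ofPositive_gen]

/-- The map from the braid group to the units of the localized positive braid monoid. -/
noncomputable def toUnits (n : ℕ) : BraidGroup n →*
    (OreLocalization (fullTwists (n - 1)) (PositiveBraidMonoid (n - 1)))ˣ :=
  PresentedGroup.toGroup (f := fun i => (isUnit_toLoc_gen i).unit) (lift_eq_one_of_braidRels
    (fun i j h => Units.ext <| by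
      have := (isGarsideSeq (n - 1)).comm i j h j.isLt
      rw [s_val, s_val] at this
      simpa using congrArg (toLoc (n - 1)) this)
    (fun i j h => Units.ext <| by
      have := (isGarsideSeq (n - 1)).braid i (h ▸ j.isLt)
      rw [h, s_val, s_val] at this
      simpa using congrArg (toLoc (n - 1)) this))

theorem toUnits_σ (i : Fin (n - 1)) :
    (toUnits n (σ i) : OreLocalization _ _) = toLoc (n - 1) (gen _ i) := by
  rw [toUnits, σ, PresentedGroup.toGroup.of]
  rfl

theorem toUnits_ofPositive (x : PositiveBraidMonoid (n - 1)) :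
    (toUnits n (ofPositive n x) : OreLocalization _ _) = toLoc (n - 1) x := by
  induction x using induction_gen with
  | one => simp
  | gen_mul i x ih =>
    rw [map_mul, map_mul, Units.val_mul, ih, map_mul, ofPositive_gen, toUnits_σ]

theorem ofPositive_injective : Function.Injective (ofPositive n) := by
  intro x y h
  refine toLoc_injective ?_
  rw [← toUnits_ofPositive, ← toUnits_ofPositive, h]

theorem closure_range_σ : Subgroup.closure (Set.range (σ : Fin (n - 1) → BraidGroup n)) = ⊤ :=
  PresentedGroup.closure_range_of _

theorem mem_center_of_commute_σ {z : BraidGroup n} (h : ∀ i, Commute (σ i) z) :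
    z ∈ Subgroup.center (BraidGroup n) := by
  have : Subgroup.closure (Set.range (σ : Fin (n - 1) → BraidGroup n)) ≤
      Subgroup.centralizer {z} := by
    rw [Subgroup.closure_le]
    rintro _ ⟨i, rfl⟩
    exact Subgroup.mem_centralizer_singleton_iff.2 (h i).eq
  rw [closure_range_σ] at this
  exact Subgroup.mem_center_iff.2 fun g =>
    Subgroup.mem_centralizer_singleton_iff.1 (this (Subgroup.mem_top g))

theorem Δ_sq_mem_center (n : ℕ) : Δ n ^ 2 ∈ Subgroup.center (BraidGroup n) :=
  mem_center_of_commute_σ fun i => by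
    rw [← ofPositive_Δ, ← map_pow, ← ofPositive_gen]
    exact (commute_Δ_sq _).map (ofPositive n)

/-- An inverse generator is `Δ⁻²` times a positive braid because each generator divides `Δ²`;
centrality collects the powers in front. -/
theorem exists_eq_zpow_mul_ofPositive (z : BraidGroup n) :
    ∃ (k : ℤ) (x : PositiveBraidMonoid (n - 1)), z = (Δ n ^ 2) ^ k * ofPositive n x := by
  have hc : ∀ (k : ℤ) (g : BraidGroup n), g * (Δ n ^ 2) ^ k = (Δ n ^ 2) ^ k * g := fun k =>
    Subgroup.mem_center_iff.1 (Subgroup.zpow_mem _ (Δ_sq_mem_center n) k)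
  have hz : z ∈ Subgroup.closure (Set.range (σ : Fin (n - 1) → BraidGroup n)) := by
    rw [closure_range_σ]; trivial
  induction hz using Subgroup.closure_induction_left with
  | one => exact ⟨0, 1, by simp⟩
  | mul_left g hg y _ ih =>
    obtain ⟨i, rfl⟩ := hg
    obtain ⟨k, x, rfl⟩ := ih
    exact ⟨k, gen _ i * x, by rw [← mul_assoc, hc, map_mul, mul_assoc]; rfl⟩
  | inv_mul_cancel g hg y _ ih =>
    obtain ⟨i, rfl⟩ := hg
    obtain ⟨k, x, rfl⟩ := ih
    obtain ⟨r, hr, -⟩ := exists_gen_mul_eq_Δ_sq i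
    have hr' : (σ i)⁻¹ = (Δ n ^ 2) ^ (-1 : ℤ) * ofPositive n r := by
      have := congrArg (ofPositive n) hr
      rw [map_mul, map_pow, ofPositive_Δ, ofPositive_gen] at this
      rw [← hc, zpow_neg_one, ← this]
      group
    refine ⟨-1 + k, r * x, ?_⟩
    rw [← mul_assoc, hc, hr', add_comm, zpow_add, map_mul]
    simp only [mul_assoc]

theorem not_isOfFinOrder_Δ_sq (hn : 1 < n) : ¬ IsOfFinOrder (Δ n ^ 2) := by
  intro h
  obtain ⟨k, hk, h1⟩ := isOfFinOrder_iff_pow_eq_one.1 h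
  rw [← ofPositive_Δ, ← map_pow, ← map_pow, ← map_one (ofPositive n)] at h1
  have h2 := congrArg length (ofPositive_injective h1)
  obtain ⟨c, hc⟩ := gen_dvd_Δ (⟨0, by omega⟩ : Fin (n - 1))
  rw [length_pow, length_pow, hc, length_mul, length_gen, length_one] at h2
  simp at h2
  omega

end BraidGroup

/-- For `n > 2` the center of the braid group `B_n` is the subgroup generated by the full twist
`Δ²`, and this cyclic group is infinite. -/
theorem mainTheorem3 (n : ℕ) (hn : 2 < n) :
    Subgroup.center (BraidGroup n) = Subgroup.zpowers (BraidGroup.Δ n ^ 2) ∧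
      ¬ IsOfFinOrder (BraidGroup.Δ n ^ 2) := by
  refine ⟨le_antisymm (fun z hz => ?_) ?_, BraidGroup.not_isOfFinOrder_Δ_sq (by omega)⟩
  · obtain ⟨k, x, rfl⟩ := BraidGroup.exists_eq_zpow_mul_ofPositive z
    -- The power of `Δ²` is central, so centrality of the product passes to the positive factor.
    have hx : BraidGroup.ofPositive n x ∈ Subgroup.center (BraidGroup n) :=
      (Subgroup.mul_mem_cancel_left _
        (Subgroup.zpow_mem _ (BraidGroup.Δ_sq_mem_center n) k)).1 hz
    obtain ⟨l, rfl⟩ := PositiveBraidMonoid.eq_Δ_sq_pow_of_central (by omega) x fun i =>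
      BraidGroup.ofPositive_injective (by
        rw [map_mul, map_mul]
        exact Subgroup.mem_center_iff.1 hx _)
    rw [map_pow, map_pow, BraidGroup.ofPositive_Δ]
    exact Subgroup.mul_mem _ (Subgroup.zpow_mem _ (Subgroup.mem_zpowers _) k)
      (Subgroup.pow_mem _ (Subgroup.mem_zpowers _) l)
  · exact (Subgroup.zpowers_le).2 (BraidGroup.Δ_sq_mem_center n)
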